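/- Let $n_1,n_2,n_3$ be positive integers. For a tensor $\mathcal{A}\in\mathbb{R}^{n_1\times n_2\times n_3}$ with frontal slices $A^{(1)},\dots,A^{(n_3)}\in\mathbb{R}^{n_1\times n_2}$, let $\operatorname{bcirc}(\mathcal{A})\in\mathbb{R}^{n_1n_3\times n_2n_3}$ be the block circulant matrix whose block in position $(k,l)$, $1\le k,l\le n_3$, is $A^{(m)}$ with $m\equiv k-l+1 \pmod{n_3}$, $1\le m\le n_3$. Define the tensor spectral norm, the tensor nuclear norm and the tensor average rank by $$\|\mathcal{A}\|=\|\operatorname{bcirc}(\mathcal{A})\|,\qquad \|\mathcal{A}\|_*=\frac{1}{n_3}\|\operatorname{bcirc}(\mathcal{A})\|_*,\qquad \operatorname{rank}_{\mathrm a}(\mathcal{A})=\frac{1}{n_3}\operatorname{rank}(\operatorname{bcirc}(\mathcal{A})),$$ where on the right-hand sides $\|\cdot\|$ is the matrix spectral norm (largest singular value) and $\|\cdot\|_*$ the matrix nuclear norm (sum of the singular values). Then, on the set $S=\{\mathcal{A}\in\mathbb{R}^{n_1\times n_2\times n_3} : \|\mathcal{A}\|\le 1\}$, the tensor nuclear norm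 $\|\cdot\|_*$ is the convex envelope of the tensor average rank $\operatorname{rank}_{\mathrm a}$. That is, $\|\cdot\|_*$ is convex on $S$; $\|\mathcal{A}\|_*\le\operatorname{rank}_{\mathrm a}(\mathcal{A})$ for all $\mathcal{A}\in S$; and every function $h:S\to\mathbb{R}$ that is convex on $S$ and satisfies $h\le\operatorname{rank}_{\mathrm a}$ on $S$ also satisfies $h\le\|\cdot\|_*$ on $S$. -/

import Mathlib

noncomputable section

/-- Real third-order tensors of size `n₁ × n₂ × n₃`. The entry `A i j k` belongs to the
`k`-th frontal slice of `A`. -/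
abbrev Tensor3 (n₁ n₂ n₃ : ℕ) : Type := Fin n₁ → Fin n₂ → Fin n₃ → ℝ

/-- The block circulant matrix of a tensor: an `n₃ × n₃` array of `n₁ × n₂` blocks, whose block
in position `(k, l)` is the frontal slice with index `k - l` modulo `n₃` (subtraction in `Fin n₃`
is modulo `n₃`). So the first block column is `A⁽¹⁾, A⁽²⁾, …` from top to bottom. -/
def Tensor3.bcirc {n₁ n₂ n₃ : ℕ} (A : Tensor3 n₁ n₂ n₃) :
    Matrix (Fin n₃ × Fin n₁) (Fin n₃ × Fin n₂) ℝ :=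
  Matrix.of fun p q => A p.2 q.2 (p.1 - q.1)

open scoped Matrix.Norms.L2Operator in
/-- The spectral norm of a real matrix: its operator norm between Euclidean spaces. -/
def matrixSpectralNorm {m n : Type*} [Fintype m] [DecidableEq m] [Fintype n] [DecidableEq n]
    (M : Matrix m n ℝ) : ℝ :=
  ‖M‖

/-- The nuclear norm of a real matrix: the sum of its singular values. -/
def matrixNuclearNorm {m n : Type*} [Fintype m] [DecidableEq m] [Fintype n] [DecidableEq n]
    (M : Matrix m n ℝ) : ℝ :=
  ∑ i ∈ Finset.range (min (Fintype.card m) (Fintype.card n)),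
    (Matrix.toEuclideanLin M).singularValues i

/-- The tensor spectral norm `‖A‖ = ‖bcirc(A)‖`. -/
def Tensor3.spectralNorm {n₁ n₂ n₃ : ℕ} (A : Tensor3 n₁ n₂ n₃) : ℝ :=
  matrixSpectralNorm A.bcirc

/-- The tensor nuclear norm `‖A‖_* = (1/n₃) ‖bcirc(A)‖_*`. -/
def Tensor3.nuclearNorm {n₁ n₂ n₃ : ℕ} (A : Tensor3 n₁ n₂ n₃) : ℝ :=
  (1 / (n₃ : ℝ)) * matrixNuclearNorm A.bcirc

/-- The tensor average rank `rank_a(A) = (1/n₃) rank(bcirc(A))`. -/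
def Tensor3.averageRank {n₁ n₂ n₃ : ℕ} (A : Tensor3 n₁ n₂ n₃) : ℝ :=
  (1 / (n₃ : ℝ)) * (A.bcirc.rank : ℝ)

/-- `g` is the convex envelope of `f` over `S`: on `S`, it is the largest convex function that
does not exceed `f`. -/
def IsConvexEnvelopeOn {E : Type*} [AddCommGroup E] [Module ℝ E]
    (S : Set E) (f g : E → ℝ) : Prop :=
  ConvexOn ℝ S g ∧ (∀ x ∈ S, g x ≤ f x) ∧
    ∀ h : E → ℝ, ConvexOn ℝ S h → (∀ x ∈ S, h x ≤ f x) → ∀ x ∈ S, h x ≤ g x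

end

open Module Polynomial

open scoped InnerProductSpace Matrix

/-! ### Right singular vectors and truncated polar factors. -/

namespace LinearMap

/-! Convexity is duality: the nuclear norm of `T` is the maximum of the linear functionals `tr(X*
T)` over contractions `X`, attained at the polar factor. The bound by the rank holds because only
rank-many singular values are nonzero, each at most 1.

Maximality is a layer-cake argument. With decreasing singular values `σ j`, `T = ∑ (σ j - σ (j + 1))
• W j`, where `W j` is the polar factor truncated at level `σ j` (`eq_sum_truncatedPolarFactor`).
The weights sum to `σ 0 ≤ 1`, and the zero map takes the rest. Jensen then bounds `h` by the
weighted ranks, which sum to at most the nuclear norm (`sum_sub_mul_finrank_range_le`).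

For tensors each `W j` must again be block circulant. It is, since `W j = T p(T* T)` for a
polynomial `p` (`exists_isTruncatedPolarFactor`), and block circulant matrices are closed under
transposes and products; no Fourier transform is needed. -/

lemma norm_map_le_of_pairwise_inner_eq_zero {E F ι : Type*} [NormedAddCommGroup E]
    [InnerProductSpace ℝ E] [NormedAddCommGroup F] [InnerProductSpace ℝ F] [Fintype ι]
    (b : OrthonormalBasis ι ℝ E) (S : E →ₗ[ℝ] F)
    (horth : Pairwise fun i j => ⟪S (b i), S (b j)⟫_ℝ = 0) (hnorm : ∀ i, ‖S (b i)‖ ≤ 1)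
    (x : E) : ‖S x‖ ≤ ‖x‖ := by
  classical
  have hS : S x = ∑ i, b.repr x i • S (b i) := by
    conv_lhs => rw [← b.sum_repr x]
    simp
  have hsq : ‖S x‖ ^ 2 = ∑ i, (b.repr x i) ^ 2 * ‖S (b i)‖ ^ 2 := by
    rw [← real_inner_self_eq_norm_sq, hS, sum_inner]
    refine Finset.sum_congr rfl fun i _ => ?_
    rw [inner_sum, Finset.sum_eq_single i]
    · rw [real_inner_smul_left, real_inner_smul_right, real_inner_self_eq_norm_sq]
      ring
    · intro j _ hj
      rw [real_inner_smul_left, real_inner_smul_right, horth hj.symm, mul_zero, mul_zero]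
    · simp
  have hx : ‖x‖ ^ 2 = ∑ i, (b.repr x i) ^ 2 := by
    rw [← b.repr.norm_map x, EuclideanSpace.norm_sq_eq]
    simp
  refine le_of_sq_le_sq ?_ (norm_nonneg x)
  rw [hsq, hx]
  refine Finset.sum_le_sum fun i _ => ?_
  exact mul_le_of_le_one_right (sq_nonneg _) (pow_le_one₀ (norm_nonneg _) (hnorm i))

variable {E F : Type*} [NormedAddCommGroup E] [InnerProductSpace ℝ E] [FiniteDimensional ℝ E]
  [NormedAddCommGroup F] [InnerProductSpace ℝ F] [FiniteDimensional ℝ F]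

/-- An orthonormal basis of right singular vectors of `T`. -/
noncomputable def rightSingularBasis (T : E →ₗ[ℝ] F) :
    OrthonormalBasis (Fin (finrank ℝ E)) ℝ E :=
  T.isSymmetric_adjoint_comp_self.eigenvectorBasis rfl

lemma adjoint_comp_self_rightSingularBasis (T : E →ₗ[ℝ] F) (i : Fin (finrank ℝ E)) :
    (adjoint T ∘ₗ T) (T.rightSingularBasis i) =
      (T.singularValues i ^ 2) • T.rightSingularBasis i := by
  rw [T.sq_singularValues_fin rfl]
  exact T.isSymmetric_adjoint_comp_self.apply_eigenvectorBasis rfl i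

lemma inner_map_rightSingularBasis (T : E →ₗ[ℝ] F) (i j : Fin (finrank ℝ E)) :
    ⟪T (T.rightSingularBasis i), T (T.rightSingularBasis j)⟫_ℝ =
      if i = j then T.singularValues i ^ 2 else 0 := by
  rw [← adjoint_inner_left, ← comp_apply, adjoint_comp_self_rightSingularBasis,
    real_inner_smul_left, T.rightSingularBasis.inner_eq_ite]
  simp

lemma norm_map_rightSingularBasis (T : E →ₗ[ℝ] F) (i : Fin (finrank ℝ E)) :
    ‖T (T.rightSingularBasis i)‖ = T.singularValues i := by
  rw [norm_eq_sqrt_real_inner, inner_map_rightSingularBasis, if_pos rfl,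
    Real.sqrt_sq (T.singularValues_nonneg i)]

lemma singularValues_le_one (T : E →ₗ[ℝ] F) (hT : ∀ x, ‖T x‖ ≤ ‖x‖) (i : ℕ) :
    T.singularValues i ≤ 1 := by
  by_cases hi : i < finrank ℝ E
  · rw [← T.norm_map_rightSingularBasis ⟨i, hi⟩]
    exact (hT _).trans_eq (T.rightSingularBasis.norm_eq_one _)
  · rw [T.singularValues_of_finrank_le (not_lt.mp hi)]
    exact zero_le_one

lemma sum_range_singularValues (T : E →ₗ[ℝ] F) {k : ℕ} (hk : finrank ℝ T.range ≤ k) :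
    ∑ i ∈ Finset.range k, T.singularValues i =
      ∑ i ∈ Finset.range (finrank ℝ T.range), T.singularValues i := by
  refine (Finset.sum_subset (Finset.range_mono hk) fun i _ hi => ?_).symm
  rw [Finset.mem_range, not_lt] at hi
  exact T.singularValues_eq_zero_iff_le_finrank_range.mpr hi

/-- `W` acts as the partial isometry of the polar decomposition of `T` on the right singular
vectors whose singular value is positive and at least `r`, and as zero on the others. -/
def IsTruncatedPolarFactor (T W : E →ₗ[ℝ] F) (r : ℝ) : Prop :=
  ∀ i, W (T.rightSingularBasis i) =
    if r ≤ T.singularValues i ∧ 0 < T.singularValues i then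
      (T.singularValues i)⁻¹ • T (T.rightSingularBasis i) else 0

lemma IsTruncatedPolarFactor.norm_map_le {T W : E →ₗ[ℝ] F} {r : ℝ}
    (h : T.IsTruncatedPolarFactor W r) (x : E) : ‖W x‖ ≤ ‖x‖ := by
  refine norm_map_le_of_pairwise_inner_eq_zero T.rightSingularBasis W ?_ ?_ x
  · intro i j hij
    simp only [h i, h j]
    split_ifs <;> simp [real_inner_smul_left, real_inner_smul_right,
      inner_map_rightSingularBasis, hij]
  · intro i
    rw [h i]
    split_ifs with hi
    · rw [norm_smul, norm_map_rightSingularBasis, norm_inv, Real.norm_of_nonneg hi.2.le,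
        inv_mul_cancel₀ hi.2.ne']
    · simp

lemma IsTruncatedPolarFactor.finrank_range_le {T W : E →ₗ[ℝ] F} {r : ℝ}
    (h : T.IsTruncatedPolarFactor W r) :
    (finrank ℝ W.range : ℝ) ≤ ∑ i ∈ Finset.range (finrank ℝ E),
      if r ≤ T.singularValues i ∧ 0 < T.singularValues i then 1 else 0 := by
  classical
  set s : Finset (Fin (finrank ℝ E)) :=
    {i | r ≤ T.singularValues i ∧ 0 < T.singularValues i} with hs
  have hle : W.range ≤ Submodule.span ℝ
      ((s.image fun i => T (T.rightSingularBasis i) : Finset F) : Set F) := by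
    rintro _ ⟨x, rfl⟩
    rw [← T.rightSingularBasis.sum_repr x, map_sum]
    refine Submodule.sum_mem _ fun i _ => ?_
    rw [map_smul, h i]
    refine Submodule.smul_mem _ _ ?_
    split_ifs with hi
    · refine Submodule.smul_mem _ _ (Submodule.subset_span ?_)
      rw [Finset.mem_coe]
      exact Finset.mem_image_of_mem _ (by simpa [hs] using hi)
    · exact Submodule.zero_mem _
  have hcard : finrank ℝ W.range ≤ s.card :=
    (Submodule.finrank_mono hle).trans
      ((finrank_span_finset_le_card _).trans Finset.card_image_le)
  rw [Finset.sum_range fun i =>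
    if r ≤ T.singularValues i ∧ 0 < T.singularValues i then (1 : ℝ) else 0, Finset.sum_boole]
  exact_mod_cast hcard

lemma sum_inner_polarFactor {T W : E →ₗ[ℝ] F} (h : T.IsTruncatedPolarFactor W 0) :
    ∑ i, ⟪W (T.rightSingularBasis i), T (T.rightSingularBasis i)⟫_ℝ =
      ∑ i : Fin (finrank ℝ E), T.singularValues i := by
  refine Finset.sum_congr rfl fun i _ => ?_
  rw [h i]
  split_ifs with hi
  · rw [real_inner_smul_left, inner_map_rightSingularBasis, if_pos rfl, sq,
      inv_mul_cancel_left₀ hi.2.ne']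
  · have h0 := T.singularValues_nonneg i
    rw [inner_zero_left]
    exact le_antisymm h0 (not_lt.mp fun hlt => hi ⟨h0, hlt⟩)

/-- In the right singular basis, Cauchy–Schwarz bounds the i-th diagonal term by the i-th singular
value. -/
lemma trace_adjoint_comp_le_sum_singularValues (X T : E →ₗ[ℝ] F) (hX : ∀ x, ‖X x‖ ≤ ‖x‖) :
    (adjoint X ∘ₗ T).trace ℝ E ≤ ∑ i : Fin (finrank ℝ E), T.singularValues i := by
  rw [trace_eq_sum_inner _ T.rightSingularBasis]
  refine Finset.sum_le_sum fun i _ => ?_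
  rw [comp_apply, adjoint_inner_right]
  refine (real_inner_le_norm _ _).trans ?_
  rw [norm_map_rightSingularBasis]
  refine mul_le_of_le_one_left (T.singularValues_nonneg i) ?_
  exact (hX _).trans_eq (T.rightSingularBasis.norm_eq_one _)

lemma trace_adjoint_polarFactor_comp {T W : E →ₗ[ℝ] F} (h : T.IsTruncatedPolarFactor W 0) :
    (adjoint W ∘ₗ T).trace ℝ E = ∑ i : Fin (finrank ℝ E), T.singularValues i := by
  rw [trace_eq_sum_inner _ T.rightSingularBasis, ← sum_inner_polarFactor h]
  simp only [comp_apply, adjoint_inner_right]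

end LinearMap

/-! ### The layer-cake decomposition. -/

lemma Antitone.sum_sub_mul_ite_eq_sub {σ : ℕ → ℝ} (hσ : Antitone σ) {i n : ℕ} (hin : i ≤ n)
    (hi : 0 < σ i) :
    ∑ j ∈ Finset.range n, (σ j - σ (j + 1)) * (if σ j ≤ σ i ∧ 0 < σ i then 1 else 0) =
      σ i - σ n := by
  induction n, hin using Nat.le_induction with
  | base =>
    rw [sub_self]
    -- For `j < i` the indicator is nonzero only if `σ j = σ i`, and then `σ j = σ (j + 1)`, so ties
    -- contribute nothing.
    refine Finset.sum_eq_zero fun j hj => ?_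
    have hji : j + 1 ≤ i := Finset.mem_range.mp hj
    split_ifs with h
    · have h1 := hσ hji
      have h2 := hσ (Nat.le_succ j)
      rw [mul_one]
      linarith [h.1]
    · rw [mul_zero]
  | succ n hn ih =>
    rw [Finset.sum_range_succ, ih, if_pos ⟨hσ hn, hi⟩]
    ring

namespace LinearMap

variable {E F : Type*} [NormedAddCommGroup E] [InnerProductSpace ℝ E] [FiniteDimensional ℝ E]
  [NormedAddCommGroup F] [InnerProductSpace ℝ F] [FiniteDimensional ℝ F]

lemma sum_singularValues_sub_mul_ite (T : E →ₗ[ℝ] F) {i : ℕ} (hi : i < finrank ℝ E) :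
    ∑ j ∈ Finset.range (finrank ℝ E), (T.singularValues j - T.singularValues (j + 1)) *
      (if T.singularValues j ≤ T.singularValues i ∧ 0 < T.singularValues i then 1 else 0) =
      T.singularValues i := by
  rcases (T.singularValues_nonneg i).eq_or_lt with h0 | h0
  · simp [← h0]
  · rw [T.singularValues_antitone.sum_sub_mul_ite_eq_sub hi.le h0,
      T.singularValues_of_finrank_le le_rfl, sub_zero]

/-- The layer-cake decomposition of a linear map into its truncated polar factors. -/
lemma eq_sum_truncatedPolarFactor (T : E →ₗ[ℝ] F) (W : ℕ → E →ₗ[ℝ] F)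
    (hW : ∀ j, T.IsTruncatedPolarFactor (W j) (T.singularValues j)) :
    T = ∑ j ∈ Finset.range (finrank ℝ E),
      (T.singularValues j - T.singularValues (j + 1)) • W j := by
  refine T.rightSingularBasis.toBasis.ext fun i => ?_
  rw [OrthonormalBasis.coe_toBasis, sum_apply]
  have key : ∀ j, ((T.singularValues j - T.singularValues (j + 1)) • W j)
      (T.rightSingularBasis i) =
      ((T.singularValues j - T.singularValues (j + 1)) *
        (if T.singularValues j ≤ T.singularValues i ∧ 0 < T.singularValues i then 1 else 0)) •
        ((T.singularValues i)⁻¹ • T (T.rightSingularBasis i)) := by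
    intro j
    rw [smul_apply, hW j i]
    split_ifs <;> simp
  rw [Finset.sum_congr rfl fun j _ => key j, ← Finset.sum_smul,
    T.sum_singularValues_sub_mul_ite i.isLt, smul_smul]
  rcases eq_or_ne (T.singularValues i) 0 with h0 | h0
  · have : T (T.rightSingularBasis i) = 0 := by
      rw [← norm_eq_zero, norm_map_rightSingularBasis, h0]
    rw [this, smul_zero]
  · rw [mul_inv_cancel₀ h0, one_smul]

lemma sum_sub_mul_finrank_range_le (T : E →ₗ[ℝ] F) (W : ℕ → E →ₗ[ℝ] F)
    (hW : ∀ j, T.IsTruncatedPolarFactor (W j) (T.singularValues j)) :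
    ∑ j ∈ Finset.range (finrank ℝ E),
      (T.singularValues j - T.singularValues (j + 1)) * (finrank ℝ (W j).range : ℝ) ≤
      ∑ i ∈ Finset.range (finrank ℝ E), T.singularValues i := by
  calc _ ≤ ∑ j ∈ Finset.range (finrank ℝ E), ∑ i ∈ Finset.range (finrank ℝ E),
        (T.singularValues j - T.singularValues (j + 1)) *
        (if T.singularValues j ≤ T.singularValues i ∧ 0 < T.singularValues i then 1 else 0) := by
        refine Finset.sum_le_sum fun j _ => ?_
        rw [← Finset.mul_sum]
        exact mul_le_mul_of_nonneg_left (hW j).finrank_range_le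
          (sub_nonneg.mpr (T.singularValues_antitone (Nat.le_succ j)))
    _ = ∑ i ∈ Finset.range (finrank ℝ E), T.singularValues i := by
        rw [Finset.sum_comm]
        exact Finset.sum_congr rfl fun i hi =>
          T.sum_singularValues_sub_mul_ite (Finset.mem_range.mp hi)

lemma aeval_apply_of_apply_eq_smul {V : Type*} [AddCommGroup V] [Module ℝ V] {f : V →ₗ[ℝ] V}
    {c : ℝ} {x : V} (h : f x = c • x) (p : ℝ[X]) : aeval f p x = p.eval c • x := by
  induction p using Polynomial.induction_on' with
  | add p q hp hq => simp [hp, hq, add_smul]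
  | monomial k a =>
    have hk : (f ^ k) x = c ^ k • x := by
      induction k with
      | zero => simp
      | succ k ih => rw [pow_succ', Module.End.mul_apply, ih, map_smul, h, smul_smul, pow_succ]
    rw [aeval_monomial, eval_monomial, Module.End.mul_apply, hk]
    simp [smul_smul, mul_comm]

lemma exists_isTruncatedPolarFactor (T : E →ₗ[ℝ] F) (r : ℝ) :
    ∃ p : ℝ[X], T.IsTruncatedPolarFactor
      (T ∘ₗ (aeval (adjoint T ∘ₗ T : End ℝ E) p : End ℝ E)) r := by
  classical
  -- Applied to the eigenvalues `σ i ^ 2` of `T* T`, `g` gives the factors `(σ i)⁻¹` or 0. Taking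
  -- the nodes as a `Finset` merges repeated singular values.
  let g : ℝ → ℝ := fun x => if r ≤ √x ∧ 0 < √x then (√x)⁻¹ else 0
  let s : Finset ℝ := Finset.univ.image fun i : Fin (finrank ℝ E) => T.singularValues i ^ 2
  refine ⟨Lagrange.interpolate s _root_.id g, fun i => ?_⟩
  have hi : T.singularValues i ^ 2 ∈ s := Finset.mem_image_of_mem _ (Finset.mem_univ i)
  have heval : (Lagrange.interpolate s _root_.id g).eval (T.singularValues i ^ 2) =
      g (T.singularValues i ^ 2) :=
    Lagrange.eval_interpolate_at_node (v := _root_.id) g (Set.injOn_id _) hi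
  rw [comp_apply, aeval_apply_of_apply_eq_smul (T.adjoint_comp_self_rightSingularBasis i), heval,
    map_smul]
  simp only [g, Real.sqrt_sq (T.singularValues_nonneg i)]
  split_ifs <;> simp

end LinearMap

/-! ### Spectral norm, nuclear norm and rank of matrices. -/

section Matrix

lemma Matrix.rank_eq_finrank_range_toEuclideanLin {m n : Type*} [Fintype m] [Fintype n]
    [DecidableEq n] (M : Matrix m n ℝ) :
    M.rank = finrank ℝ (Matrix.toEuclideanLin M).range :=
  M.rank_eq_finrank_range_toLin (PiLp.basisFun 2 ℝ m) (PiLp.basisFun 2 ℝ n)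

variable {m n : Type*} [Fintype m] [DecidableEq m] [Fintype n] [DecidableEq n]

lemma matrixSpectralNorm_le_one_iff (M : Matrix m n ℝ) :
    matrixSpectralNorm M ≤ 1 ↔ ∀ x, ‖Matrix.toEuclideanLin M x‖ ≤ ‖x‖ := by
  rw [matrixSpectralNorm, Matrix.l2_opNorm_def, ContinuousLinearMap.opNorm_le_iff zero_le_one]
  simp

lemma matrixNuclearNorm_eq_sum_range_rank (M : Matrix m n ℝ) :
    matrixNuclearNorm M = ∑ i ∈ Finset.range M.rank, (Matrix.toEuclideanLin M).singularValues i := by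
  rw [matrixNuclearNorm, M.rank_eq_finrank_range_toEuclideanLin]
  refine LinearMap.sum_range_singularValues _ ?_
  rw [← M.rank_eq_finrank_range_toEuclideanLin]
  exact le_min M.rank_le_card_height M.rank_le_card_width

lemma matrixNuclearNorm_eq_sum_range_finrank (M : Matrix m n ℝ) :
    matrixNuclearNorm M = ∑ i ∈ Finset.range (finrank ℝ (EuclideanSpace ℝ n)),
      (Matrix.toEuclideanLin M).singularValues i := by
  rw [matrixNuclearNorm_eq_sum_range_rank, M.rank_eq_finrank_range_toEuclideanLin]
  exact (LinearMap.sum_range_singularValues _ (LinearMap.finrank_range_le _)).symm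

lemma matrixNuclearNorm_le_rank (M : Matrix m n ℝ) (hM : matrixSpectralNorm M ≤ 1) :
    matrixNuclearNorm M ≤ M.rank := by
  rw [matrixNuclearNorm_eq_sum_range_rank]
  refine (Finset.sum_le_card_nsmul _ _ 1 fun i _ => ?_).trans_eq (by simp)
  exact LinearMap.singularValues_le_one _ ((matrixSpectralNorm_le_one_iff M).mp hM) i

lemma convexOn_matrixNuclearNorm :
    ConvexOn ℝ Set.univ (matrixNuclearNorm : Matrix m n ℝ → ℝ) := by
  refine ⟨convex_univ, fun A _ B _ a b ha hb _ => ?_⟩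
  simp only [matrixNuclearNorm_eq_sum_range_finrank, smul_eq_mul, Finset.sum_range]
  -- The polar factor of the combination attains its nuclear norm and, being a contraction, also
  -- tests `A` and `B`.
  obtain ⟨W, hW⟩ : ∃ W, (Matrix.toEuclideanLin (a • A + b • B)).IsTruncatedPolarFactor W 0 :=
    (LinearMap.exists_isTruncatedPolarFactor _ 0).imp' _ fun _ => id
  rw [← LinearMap.trace_adjoint_polarFactor_comp hW, map_add, map_smul, map_smul,
    LinearMap.comp_add, LinearMap.comp_smul, LinearMap.comp_smul, map_add, map_smul, map_smul,
    smul_eq_mul, smul_eq_mul]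
  exact add_le_add
    (mul_le_mul_of_nonneg_left
      (LinearMap.trace_adjoint_comp_le_sum_singularValues _ _ hW.norm_map_le) ha)
    (mul_le_mul_of_nonneg_left
      (LinearMap.trace_adjoint_comp_le_sum_singularValues _ _ hW.norm_map_le) hb)

open scoped Matrix.Norms.L2Operator in
lemma convexOn_matrixSpectralNorm :
    ConvexOn ℝ Set.univ (matrixSpectralNorm : Matrix m n ℝ → ℝ) :=
  convexOn_norm convex_univ

lemma Matrix.toEuclideanLin_mul {k l o : Type*} [Fintype k] [Fintype l] [DecidableEq l]
    [Fintype o] [DecidableEq o] (P : Matrix k l ℝ) (Q : Matrix l o ℝ) :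
    Matrix.toEuclideanLin (P * Q) = Matrix.toEuclideanLin P ∘ₗ Matrix.toEuclideanLin Q :=
  Matrix.toLin_mul (PiLp.basisFun 2 ℝ o) (PiLp.basisFun 2 ℝ l) (PiLp.basisFun 2 ℝ k) P Q

lemma Matrix.toEuclideanLin_mul_aeval (M : Matrix m n ℝ) (p : ℝ[X]) :
    Matrix.toEuclideanLin (M * aeval (Mᵀ * M) p) =
      Matrix.toEuclideanLin M ∘ₗ
        aeval (LinearMap.adjoint (Matrix.toEuclideanLin M) ∘ₗ Matrix.toEuclideanLin M) p := by
  have hadj : LinearMap.adjoint (Matrix.toEuclideanLin M) ∘ₗ Matrix.toEuclideanLin M =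
      Matrix.toEuclideanLin (Mᵀ * M) := by
    rw [Matrix.toEuclideanLin_mul, ← Matrix.toEuclideanLin_conjTranspose_eq_adjoint,
      Matrix.conjTranspose_eq_transpose_of_trivial]
  have haeval (N : Matrix n n ℝ) :
      Matrix.toEuclideanLin (aeval N p) = aeval (Matrix.toEuclideanLin N) p :=
    (aeval_algHom_apply (Matrix.toLinAlgEquiv (PiLp.basisFun 2 ℝ n)) N p).symm
  rw [Matrix.toEuclideanLin_mul, hadj, haeval]

end Matrix

/-! ### Block circulant matrices and the tensor statement. -/

namespace Tensor3

variable {n₁ n₂ n₃ : ℕ}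

/-- `Tensor3.bcirc` as a linear map. -/
def bcircLinear : Tensor3 n₁ n₂ n₃ →ₗ[ℝ] Matrix (Fin n₃ × Fin n₁) (Fin n₃ × Fin n₂) ℝ where
  toFun := bcirc
  map_add' _ _ := rfl
  map_smul' _ _ := rfl

lemma bcirc_injective [NeZero n₃] :
    Function.Injective (bcirc : Tensor3 n₁ n₂ n₃ → _) := by
  intro A B h
  funext i j k
  have := congrFun (congrFun h (k, i)) (0, j)
  simpa [bcirc] using this

/-- A matrix is block circulant if it does not change when the block rows and the block columns
are cyclically shifted by the same amount. -/
def IsBlockCirculant [NeZero n₃] {α β : Type*} (M : Matrix (Fin n₃ × α) (Fin n₃ × β) ℝ) : Prop :=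
  ∀ s : Fin n₃, M.submatrix ((Equiv.addRight s).prodCongr (Equiv.refl α))
    ((Equiv.addRight s).prodCongr (Equiv.refl β)) = M

lemma isBlockCirculant_bcirc [NeZero n₃] (A : Tensor3 n₁ n₂ n₃) : IsBlockCirculant A.bcirc := by
  intro s
  ext p q
  simp [bcirc]

lemma IsBlockCirculant.exists_bcirc_eq [NeZero n₃]
    {M : Matrix (Fin n₃ × Fin n₁) (Fin n₃ × Fin n₂) ℝ} (hM : IsBlockCirculant M) :
    ∃ A : Tensor3 n₁ n₂ n₃, A.bcirc = M := by
  refine ⟨fun i j k => M (k, i) (0, j), ?_⟩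
  ext ⟨k, i⟩ ⟨l, j⟩
  -- A shift by `l` carries block `(k - l, 0)` to block `(k, l)`.
  have := congrFun (congrFun (hM l) (k - l, i)) (0, j)
  simpa [bcirc] using this.symm

lemma IsBlockCirculant.transpose [NeZero n₃] {α β : Type*}
    {M : Matrix (Fin n₃ × α) (Fin n₃ × β) ℝ} (hM : IsBlockCirculant M) :
    IsBlockCirculant M.transpose := fun s => by
  rw [← Matrix.transpose_submatrix, hM s]

lemma IsBlockCirculant.mul [NeZero n₃] {α β γ : Type*} [Fintype β]
    {M : Matrix (Fin n₃ × α) (Fin n₃ × β) ℝ} {N : Matrix (Fin n₃ × β) (Fin n₃ × γ) ℝ}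
    (hM : IsBlockCirculant M) (hN : IsBlockCirculant N) : IsBlockCirculant (M * N) := fun s => by
  conv_rhs => rw [← hM s, ← hN s]
  exact (Matrix.submatrix_mul_equiv M N _ _ _).symm

/-- The simultaneous shift is an algebra automorphism, so it commutes with polynomial evaluation. -/
lemma IsBlockCirculant.aeval [NeZero n₃] {α : Type*} [Fintype α] [DecidableEq α]
    {M : Matrix (Fin n₃ × α) (Fin n₃ × α) ℝ} (hM : IsBlockCirculant M) (p : ℝ[X]) :
    IsBlockCirculant (aeval M p) := fun s => by
  have h := aeval_algHom_apply
    (Matrix.reindexAlgEquiv ℝ ℝ ((Equiv.addRight s).prodCongr (Equiv.refl α)).symm) M p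
  simp only [Matrix.coe_reindexAlgEquiv, Matrix.reindex_apply, Equiv.symm_symm] at h
  rw [← h, hM s]

lemma exists_bcirc_isTruncatedPolarFactor [NeZero n₃] (A : Tensor3 n₁ n₂ n₃) (r : ℝ) :
    ∃ B : Tensor3 n₁ n₂ n₃, (Matrix.toEuclideanLin A.bcirc).IsTruncatedPolarFactor
      (Matrix.toEuclideanLin B.bcirc) r := by
  obtain ⟨p, hp⟩ := (Matrix.toEuclideanLin A.bcirc).exists_isTruncatedPolarFactor r
  have hA := isBlockCirculant_bcirc A
  obtain ⟨B, hB⟩ := (hA.mul ((hA.transpose.mul hA).aeval p)).exists_bcirc_eq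
  exact ⟨B, by rwa [hB, Matrix.toEuclideanLin_mul_aeval]⟩

lemma convexOn_nuclearNorm : ConvexOn ℝ Set.univ (nuclearNorm : Tensor3 n₁ n₂ n₃ → ℝ) :=
  (convexOn_matrixNuclearNorm.comp_linearMap bcircLinear).smul (by positivity)

lemma convex_spectralNorm_le_one : Convex ℝ {A : Tensor3 n₁ n₂ n₃ | A.spectralNorm ≤ 1} := by
  have h := (convexOn_matrixSpectralNorm.comp_linearMap
    (bcircLinear : Tensor3 n₁ n₂ n₃ →ₗ[ℝ] _)).convex_le 1
  simp only [Set.preimage_univ, Set.mem_univ, true_and] at h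
  exact h

lemma averageRank_zero : (0 : Tensor3 n₁ n₂ n₃).averageRank = 0 := by
  have h : (0 : Tensor3 n₁ n₂ n₃).bcirc = 0 := map_zero bcircLinear
  rw [averageRank, h, Matrix.rank_zero, Nat.cast_zero, mul_zero]

lemma zero_mem_spectralNorm_le_one :
    (0 : Tensor3 n₁ n₂ n₃) ∈ {A : Tensor3 n₁ n₂ n₃ | A.spectralNorm ≤ 1} := by
  have h : (0 : Tensor3 n₁ n₂ n₃).bcirc = 0 := map_zero bcircLinear
  rw [Set.mem_ofPred_eq, spectralNorm, h, matrixSpectralNorm_le_one_iff]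
  simp

lemma le_nuclearNorm_of_convexOn [NeZero n₃] {h : Tensor3 n₁ n₂ n₃ → ℝ}
    (hconv : ConvexOn ℝ {A : Tensor3 n₁ n₂ n₃ | A.spectralNorm ≤ 1} h)
    (hle : ∀ A : Tensor3 n₁ n₂ n₃, A.spectralNorm ≤ 1 → h A ≤ A.averageRank)
    (A : Tensor3 n₁ n₂ n₃) (hA : A.spectralNorm ≤ 1) : h A ≤ A.nuclearNorm := by
  set T := Matrix.toEuclideanLin A.bcirc with hT
  set d := finrank ℝ (EuclideanSpace ℝ (Fin n₃ × Fin n₂)) with hd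
  set w : ℕ → ℝ := fun j => T.singularValues j - T.singularValues (j + 1) with hw
  choose B hB using fun j => exists_bcirc_isTruncatedPolarFactor A (T.singularValues j)
  have hBmem (j : ℕ) : (B j).spectralNorm ≤ 1 :=
    (matrixSpectralNorm_le_one_iff _).mpr (hB j).norm_map_le
  have hw0 (j : ℕ) : 0 ≤ w j := sub_nonneg.mpr (T.singularValues_antitone (Nat.le_succ j))
  have hwsum : ∑ j ∈ Finset.range d, w j = T.singularValues 0 := by
    rw [Finset.sum_range_sub', T.singularValues_of_finrank_le le_rfl, sub_zero]
  -- The leftover weight sits at 0, where `h` is at most 0, so this term can be dropped after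
  -- Jensen.
  have hsum : A = (1 - T.singularValues 0) • (0 : Tensor3 n₁ n₂ n₃) +
      ∑ j ∈ Finset.range d, w j • B j := by
    rw [smul_zero, zero_add]
    apply bcirc_injective
    apply Matrix.toEuclideanLin.injective
    change _ = Matrix.toEuclideanLin (bcircLinear _)
    simp only [map_sum, map_smul]
    exact T.eq_sum_truncatedPolarFactor _ hB
  have hrank : ∑ j ∈ Finset.range d, w j * (B j).averageRank ≤ A.nuclearNorm := by
    simp only [averageRank, nuclearNorm, mul_left_comm (w _)]
    rw [← Finset.mul_sum, matrixNuclearNorm_eq_sum_range_finrank]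
    refine mul_le_mul_of_nonneg_left ?_ (by positivity)
    simp only [Matrix.rank_eq_finrank_range_toEuclideanLin]
    exact T.sum_sub_mul_finrank_range_le _ hB
  have hjensen := hconv.map_add_sum_le (t := Finset.range d) (w := w) (p := B)
    (v := 1 - T.singularValues 0) (q := 0) (fun j _ => hw0 j) (by rw [hwsum, sub_add_cancel])
    (fun j _ => hBmem j)
    (sub_nonneg.mpr (T.singularValues_le_one ((matrixSpectralNorm_le_one_iff _).mp hA) 0))
    zero_mem_spectralNorm_le_one
  rw [← hsum] at hjensen
  refine hjensen.trans (le_trans ?_ hrank)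
  have hzero : (1 - T.singularValues 0) • h 0 ≤ 0 := by
    refine mul_nonpos_of_nonneg_of_nonpos (sub_nonneg.mpr
      (T.singularValues_le_one ((matrixSpectralNorm_le_one_iff _).mp hA) 0)) ?_
    exact (hle 0 zero_mem_spectralNorm_le_one).trans_eq averageRank_zero
  refine (add_le_of_nonpos_left hzero).trans (Finset.sum_le_sum fun j _ => ?_)
  exact mul_le_mul_of_nonneg_left (hle _ (hBmem j)) (hw0 j)

end Tensor3

theorem theorem3p1 (n₁ n₂ n₃ : ℕ) (hn₃ : 0 < n₃) :
    IsConvexEnvelopeOn {A : Tensor3 n₁ n₂ n₃ | A.spectralNorm ≤ 1}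
      (fun A => A.averageRank) (fun A => A.nuclearNorm) := by
  have : NeZero n₃ := ⟨hn₃.ne'⟩
  refine ⟨Tensor3.convexOn_nuclearNorm.subset (Set.subset_univ _)
    Tensor3.convex_spectralNorm_le_one, fun A hA => ?_, fun h hconv hle A hA =>
    Tensor3.le_nuclearNorm_of_convexOn hconv hle A hA⟩
  exact mul_le_mul_of_nonneg_left (matrixNuclearNorm_le_rank _ hA) (by positivity)
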